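/- **Setting.** Let $\varrho$ be a measure on $\mathbb{R}$ that is not concentrated on a single point, and let $\Phi$ be the interior of $\{\eta : \int e^{\eta x}\,\varrho(dx)<\infty\}$. For $\eta\in\Phi$ let $\nu_\eta$ be the member of the canonical exponential family with density $\exp(\eta x-b(\eta))$ with respect to $\varrho$, where $b(\eta)=\log\int e^{\eta x}\varrho(dx)$. Each $\nu_\eta$ is determined by its mean, and $d(p,q)$ denotes the Kullback–Leibler divergence between the members with means $p$ and $q$. Let $\Theta$ be an interval contained in the open interval of means of the family, $\mathcal{M}\subseteq\Theta^K$ a set of admissible bandit models (a model is identified with its vector of means), $\mathcal{X}\subseteq\mathbb{R}^d$ an answer space, and let $\mathcal{X}^\star$ map each $\mu\in\Theta^K$ to a non-empty set $\mathcal{X}^\star(\mu)\subseteq\mathcal{X}$ of correct answers. For $\widetilde{\mathcal{X}}\subseteq\mathcal{X}$ put $\lnot\widetilde{\mathcal{X}}=\{\lambda\in\mathcal{M}: x\notin\mathcal{X}^\star(\lambda)\text{ for all }x\in\widetilde{\mathcal{X}}\}$ and $\lnot x=\lnot\{x\}$; let $\mathcal{B}_\rho(x)=\{x'\in\mathcal{X}:\|x-x'\|\le\rho\}$,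 let $\Delta_K$ be the probability simplex in $\mathbb{R}^K$, and $$D(\mu,\omega,\Lambda)=\inf_{\lambda\in\Lambda}\sum_{k=1}^K\omega_k\,d(\mu_k,\lambda_k),\qquad D(\mu)=\sup_{x\in\mathcal{X}^\star(\mu)}\ \sup_{\omega\in\Delta_K} D(\mu,\omega,\lnot x).$$ The problem is *regular* if 1. $\mathcal{X}$ is compact, and $\mathcal{X}^\star(\mu)$ is compact for every $\mu\in\Theta^K$; 2. for every $\mu\in\mathcal{M}$ there is $\bar x\in\mathcal{X}^\star(\mu)$ with $\mu\notin\mathrm{cl}(\lnot\bar x)$; 3. for all sufficiently small $\epsilon>0$ there is $\rho>0$ such that, for all $\mu\in\Theta^K$, $\omega\in\Delta_K$ and $x\in\mathcal{X}$, $\lnot\mathcal{B}_\rho(x)\neq\emptyset$ and $D(\mu,\omega,\lnot\mathcal{B}_\rho(x))-D(\mu,\omega,\lnot x)\le\epsilon$. In round $t=1,2,\dots$ an algorithm selects an arm $A_t\in[K]$ and observes a reward $R_t$ drawn, given the past, from the distribution of arm $A_t$. Let $\mathcal{F}_t=\sigma((A_s,R_s)_{s\le t})$. An algorithm consists of a sampling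 rule with $A_t$ being $\mathcal{F}_{t-1}$-measurable, a stopping time $\tau$ of $(\mathcal{F}_t)_{t\ge0}$ with values in $\mathbb{N}\cup\{\infty\}$, and an $\mathcal{F}_\tau$-measurable answer $\hat x_\tau\in\mathcal{X}$. It is *$\delta$-correct* if $\mathbb{P}_\mu(\tau<\infty,\ \hat x_\tau\notin\mathcal{X}^\star(\mu))\le\delta$ for all $\mu\in\mathcal{M}$. **Theorem (Lower Bound).** Consider a regular pure exploration problem and, for each $\delta\in(0,1)$, a $\delta$-correct algorithm with stopping time $\tau_\delta$. Then for every $\mu\in\mathcal{M}$ $$\liminf_{\delta\to0}\frac{\mathbb{E}_\mu[\tau_\delta]}{\log(1/\delta)}\ \ge\ T^*(\mu)=\frac{1}{D(\mu)} .$$ -/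

import Mathlib

open MeasureTheory ProbabilityTheory Filter Topology
open scoped ENNReal

/-! ### One-parameter canonical exponential families -/

/-- The member with natural parameter `η` of the canonical exponential family generated by the
reference measure `ref` on `ℝ`: it has density `x ↦ exp (η * x - b η)` with respect to `ref`, where
`b η = log ∫ exp (η * x) ∂ref` is the log-partition function. -/
noncomputable def expFamily (ref : Measure ℝ) (η : ℝ) : Measure ℝ :=
  ref.tilted (fun x => η * x)

/-- The open interval of natural parameters of the family: the interior of
`{η | ∫ exp (η * x) ∂ref < ∞}`. -/
def naturalParams (ref : Measure ℝ) : Set ℝ :=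
  interior (integrableExpSet id ref)

/-- The means of the members of the family. -/
def meanSpace (ref : Measure ℝ) : Set ℝ :=
  {m | ∃ η ∈ naturalParams ref, ∫ x, x ∂(expFamily ref η) = m}

open Classical in
/-- The member of the family with mean `m` (and the point mass at `m` if there is none). -/
noncomputable def lawOfMean (ref : Measure ℝ) (m : ℝ) : Measure ℝ :=
  if h : m ∈ meanSpace ref then expFamily ref h.choose else Measure.dirac m

theorem isProbabilityMeasure_lawOfMean {ref : Measure ℝ} (href : ref ≠ 0) (m : ℝ) :
    IsProbabilityMeasure (lawOfMean ref m) := by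
  unfold lawOfMean
  split_ifs with h
  · have : NeZero ref := ⟨href⟩
    have hη : h.choose ∈ integrableExpSet id ref := interior_subset h.choose_spec.1
    exact isProbabilityMeasure_tilted hη
  · infer_instance

/-! ### Pure exploration problems -/

/-- A pure exploration problem with `K` arms and answers in `ℝ^d`. -/
structure PureExplorationProblem (K d : ℕ) where
  /-- Reference measure of the exponential family. -/
  ref : Measure ℝ
  /-- The family is not degenerate: the reference measure is not carried by a single point. -/
  nondegenerate : ¬ ∃ a : ℝ, ∀ᵐ x ∂ref, x = a
  /-- The interval of possible means of an arm. -/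
  Θ : Set ℝ
  ordConnected_Θ : Θ.OrdConnected
  Θ_subset : Θ ⊆ meanSpace ref
  /-- The admissible bandit models, given by their vectors of means. -/
  M : Set (Fin K → ℝ)
  M_subset : M ⊆ Set.univ.pi fun _ => Θ
  /-- The answer space. -/
  X : Set (EuclideanSpace ℝ (Fin d))
  /-- The correspondence of correct answers; only its values on `Θ^K` matter. -/
  Xstar : (Fin K → ℝ) → Set (EuclideanSpace ℝ (Fin d))
  Xstar_subset : ∀ μ ∈ Set.univ.pi (fun _ : Fin K => Θ), Xstar μ ⊆ X
  Xstar_nonempty : ∀ μ ∈ Set.univ.pi (fun _ : Fin K => Θ), (Xstar μ).Nonempty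

namespace PureExplorationProblem

variable {K d : ℕ} (P : PureExplorationProblem K d)

/-- The set `Θ^K` of all bandit models. -/
def models : Set (Fin K → ℝ) := Set.univ.pi fun _ => P.Θ

/-- The divergence `d(p, q)`: the Kullback-Leibler divergence between the members of the family
with means `p` and `q`. -/
noncomputable def kl (p q : ℝ) : ℝ≥0∞ :=
  InformationTheory.klDiv (lawOfMean P.ref p) (lawOfMean P.ref q)

/-- The alternative models for a set `S` of answers: the admissible models for which no answer
in `S` is correct. -/
def alt (S : Set (EuclideanSpace ℝ (Fin d))) : Set (Fin K → ℝ) :=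
  {l | l ∈ P.M ∧ ∀ x ∈ S, x ∉ P.Xstar l}

/-- The closed ball of radius `ρ` around `x`, relative to the answer space. -/
def ball (ρ : ℝ) (x : EuclideanSpace ℝ (Fin d)) : Set (EuclideanSpace ℝ (Fin d)) :=
  {y | y ∈ P.X ∧ ‖x - y‖ ≤ ρ}

/-- `D(μ, ω, Λ) = inf_{λ ∈ Λ} ∑ₖ ωₖ d(μₖ, λₖ)`, with values in `[0, ∞]`. -/
noncomputable def divWeighted (μ ω : Fin K → ℝ) (L : Set (Fin K → ℝ)) : ℝ≥0∞ :=
  ⨅ l ∈ L, ∑ k, ENNReal.ofReal (ω k) * P.kl (μ k) (l k)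

/-- `D(μ, Λ) = sup_{ω ∈ Δ_K} D(μ, ω, Λ)`. -/
noncomputable def divSet (μ : Fin K → ℝ) (L : Set (Fin K → ℝ)) : ℝ≥0∞ :=
  ⨆ ω ∈ stdSimplex ℝ (Fin K), P.divWeighted μ ω L

/-- `D(μ) = sup_{x ∈ X⋆(μ)} D(μ, ¬x)`. -/
noncomputable def divModel (μ : Fin K → ℝ) : ℝ≥0∞ :=
  ⨆ x ∈ P.Xstar μ, P.divSet μ (P.alt {x})

/-- Regular pure exploration problems. -/
structure IsRegular : Prop where
  isCompact_X : IsCompact P.X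
  isCompact_Xstar : ∀ μ ∈ P.models, IsCompact (P.Xstar μ)
  identifiable : ∀ μ ∈ P.M, ∃ x ∈ P.Xstar μ, μ ∉ closure (P.alt {x})
  continuous_alt : ∃ ε₀ : ℝ, 0 < ε₀ ∧ ∀ ε : ℝ, 0 < ε → ε < ε₀ → ∃ ρ : ℝ, 0 < ρ ∧
    ∀ μ ∈ P.models, ∀ ω ∈ stdSimplex ℝ (Fin K), ∀ x ∈ P.X,
      (P.alt (P.ball ρ x)).Nonempty ∧
      P.divWeighted μ ω (P.alt (P.ball ρ x)) ≤
        P.divWeighted μ ω (P.alt {x}) + ENNReal.ofReal ε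

theorem ref_ne_zero : P.ref ≠ 0 := fun h =>
  P.nondegenerate ⟨0, by simp [h]⟩

/-- The reward distributions of the bandit model `μ`, as a kernel from arms to rewards. -/
noncomputable def rewardKernel (μ : Fin K → ℝ) : Kernel (Fin K) ℝ :=
  Kernel.ofFunOfCountable fun k => lawOfMean P.ref (μ k)

instance isMarkovKernel_rewardKernel (μ : Fin K → ℝ) : IsMarkovKernel (P.rewardKernel μ) :=
  ⟨fun k => isProbabilityMeasure_lawOfMean P.ref_ne_zero (μ k)⟩

end PureExplorationProblem

/-! ### Algorithms and their interaction with a bandit model -/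

/-- Sequences of observations: the value at `n` is the pair (arm, reward) of round `n + 1`. -/
abbrev Observations (K : ℕ) : Type := ℕ → Fin K × ℝ

/-- The filtration of observations: its member with index `t` is generated by the first `t` rounds,
so that the one with index `0` is trivial. -/
def obsFiltration (K : ℕ) :
    Filtration ℕ (inferInstance : MeasurableSpace (Observations K)) where
  seq t := ⨆ s : ℕ, ⨆ _ : s < t,
    MeasurableSpace.comap (fun h : Observations K => h s) inferInstance
  mono' _ _ hij := iSup_mono fun _ => iSup_mono' fun hs => ⟨lt_of_lt_of_le hs hij, le_rfl⟩
  le' _ := iSup_le fun s => iSup_le fun _ => (measurable_pi_apply s).comap_le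

/-- A learning algorithm with `K` arms and answers in `X`: a sampling rule (the first arm, and for
the following rounds the next arm as a measurable function of the past observations), a stopping
rule and a decision rule. -/
structure BanditAlgorithm (K d : ℕ) (X : Set (EuclideanSpace ℝ (Fin d))) where
  firstArm : Fin K
  nextArm : (n : ℕ) → ((Finset.Iic n) → Fin K × ℝ) → Fin K
  measurable_nextArm : ∀ n, Measurable (nextArm n)
  /-- The number of rounds after which the algorithm stops (`⊤` if it never does). -/
  τ : Observations K → ℕ∞
  isStoppingTime_τ : IsStoppingTime (obsFiltration K) τ
  answer : Observations K → EuclideanSpace ℝ (Fin d)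
  measurable_answer : Measurable[isStoppingTime_τ.measurableSpace] answer
  answer_mem : ∀ h, answer h ∈ X

namespace PureExplorationProblem

variable {K d : ℕ} (P : PureExplorationProblem K d)

/-- The conditional law of the next observation given the past ones: the arm is chosen by the
sampling rule, the reward is drawn from the distribution of that arm in the bandit model `μ`. -/
noncomputable def stepKernel (A : BanditAlgorithm K d P.X) (μ : Fin K → ℝ) (n : ℕ) :
    Kernel ((Finset.Iic n) → Fin K × ℝ) (Fin K × ℝ) :=
  Kernel.prod (Kernel.deterministic (A.nextArm n) (A.measurable_nextArm n))
    ((P.rewardKernel μ).comap (A.nextArm n) (A.measurable_nextArm n))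

instance isMarkovKernel_stepKernel (A : BanditAlgorithm K d P.X) (μ : Fin K → ℝ) (n : ℕ) :
    IsMarkovKernel (P.stepKernel A μ n) := by
  unfold stepKernel; infer_instance

/-- The law `ℙ_μ` of the sequence of observations when the algorithm `A` interacts with the bandit
model `μ`. -/
noncomputable def law (A : BanditAlgorithm K d P.X) (μ : Fin K → ℝ) :
    Measure (Observations K) :=
  Kernel.trajMeasure (X := fun _ => Fin K × ℝ)
    ((Measure.dirac A.firstArm).prod (P.rewardKernel μ A.firstArm))
    (P.stepKernel A μ)

/-- An algorithm is `δ`-correct if, in every admissible model, the probability that it stops and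
returns an incorrect answer is at most `δ`. -/
def IsCorrect (δ : ℝ) (A : BanditAlgorithm K d P.X) : Prop :=
  ∀ μ ∈ P.M, P.law A μ {h | A.τ h ≠ ⊤ ∧ A.answer h ∉ P.Xstar μ} ≤ ENNReal.ofReal δ

/-- The expected stopping time `𝔼_μ[τ]`, with values in `[0, ∞]`. -/
noncomputable def expectedStop (A : BanditAlgorithm K d P.X) (μ : Fin K → ℝ) : ℝ≥0∞ :=
  ∫⁻ h, (A.τ h : ℝ≥0∞) ∂(P.law A μ)

end PureExplorationProblem

/-! ### Exponential families: densities, divergences, and exponential moments -/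

/-! An algorithm can stop early with an answer near `x` only if the data tell `μ` apart from every
model in which no answer near `x` is correct. Let `v > D(μ)`. Regularity gives a radius `ρ` for
which `D(μ, ω, ¬B_ρ(x)) < v` for all weights `ω` and all correct `x`. A minimax argument
(`exists_mem_convexHull_forall_lt`) exchanges the quantifiers: one finite mixture of models in
`¬B_ρ(x)` has averaged divergence from `μ` below `v` at every arm simultaneously. This mixture is
hard to detect whatever the sampling rule does.

In `exists_law_stop_le_and_answer_mem_le` the averaged log-likelihood ratio of `μ` against this
mixture gains less than `v` per round in mean, and an exponential moment bound makes it exceed `c`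
with exponentially small probability. Where it stays below `c`, Jensen's inequality and a change of
measure bound the probability of answering in the ball by `e^c δ`, since such an answer is wrong in
each model of the mixture.

Compactness of the set of correct answers leaves finitely many balls, so a union bound controls `τ ≤
n` (`exists_law_stop_le`) even though the algorithm may switch between correct answers. With `n`
about `log(1/δ) / v` and `c` slightly below `log(1/δ)`, this probability vanishes, and Markov's
inequality concludes. -/

theorem lawOfMean_eq_expFamily {ref : Measure ℝ} {m : ℝ} (hm : m ∈ meanSpace ref) :
    ∃ η ∈ naturalParams ref, lawOfMean ref m = expFamily ref η :=
  ⟨hm.choose, hm.choose_spec.1, dif_pos hm⟩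

theorem integrable_exp_of_mem_naturalParams {ref : Measure ℝ} {η : ℝ}
    (hη : η ∈ naturalParams ref) : Integrable (fun x => Real.exp (η * x)) ref :=
  interior_subset (s := integrableExpSet id ref) hη

theorem integrable_exp_expFamily_iff {ref : Measure ℝ} {η : ℝ} (hη : η ∈ naturalParams ref)
    (t : ℝ) : Integrable (fun x => Real.exp (t * x)) (expFamily ref η) ↔
      Integrable (fun x => Real.exp ((η + t) * x)) ref := by
  unfold expFamily
  rw [integrable_tilted_iff (integrable_exp_of_mem_naturalParams hη)]
  refine iff_of_eq (congrArg (Integrable · ref) (funext fun x => ?_))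
  rw [smul_eq_mul, ← Real.exp_add, add_mul]

theorem zero_mem_interior_integrableExpSet_lawOfMean {ref : Measure ℝ} {m : ℝ}
    (hm : m ∈ meanSpace ref) : 0 ∈ interior (integrableExpSet id (lawOfMean ref m)) := by
  obtain ⟨η, hη, h⟩ := lawOfMean_eq_expFamily hm
  rw [h, mem_interior_iff_mem_nhds]
  have hopen : IsOpen ((fun t : ℝ => η + t) ⁻¹' naturalParams ref) :=
    isOpen_interior.preimage (by fun_prop)
  refine mem_of_superset (hopen.mem_nhds (by simpa using hη)) fun t ht => ?_
  exact (integrable_exp_expFamily_iff hη t).2 (integrable_exp_of_mem_naturalParams ht)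

/-- Two members of the family have an exponential-affine density with respect to each other, and
their divergence is the mean of the logarithm of that density. -/
theorem exists_density_lawOfMean {ref : Measure ℝ} (href : ref ≠ 0) {p q : ℝ}
    (hp : p ∈ meanSpace ref) (hq : q ∈ meanSpace ref) :
    ∃ α β : ℝ,
      lawOfMean ref q =
        (lawOfMean ref p).withDensity (fun x => ENNReal.ofReal (Real.exp (-(α * x + β)))) ∧
      0 ≤ α * ∫ x, x ∂(lawOfMean ref p) + β ∧
      InformationTheory.klDiv (lawOfMean ref p) (lawOfMean ref q) =
        ENNReal.ofReal (α * ∫ x, x ∂(lawOfMean ref p) + β) := by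
  have hprob := isProbabilityMeasure_lawOfMean href p
  have hprob' := isProbabilityMeasure_lawOfMean href q
  have hid : Integrable (fun x : ℝ => x) (lawOfMean ref p) :=
    integrable_of_mem_interior_integrableExpSet (zero_mem_interior_integrableExpSet_lawOfMean hp)
  obtain ⟨η, hη, h⟩ := lawOfMean_eq_expFamily hp
  obtain ⟨η', hη', h'⟩ := lawOfMean_eq_expFamily hq
  set f : ℝ → ℝ := fun x => (η' - η) * x with hf
  have hexp : Integrable (fun x => Real.exp (f x)) (lawOfMean ref p) := by
    rw [h]
    refine (integrable_exp_expFamily_iff hη _).2 ?_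
    simpa using integrable_exp_of_mem_naturalParams hη'
  have htilt : lawOfMean ref q = (lawOfMean ref p).tilted f := by
    rw [h, h', expFamily, expFamily, tilted_tilted (integrable_exp_of_mem_naturalParams hη)]
    congr 1
    ext x
    simp [hf, sub_mul]
  have hpos : 0 < ∫ x, Real.exp (f x) ∂(lawOfMean ref p) := integral_exp_pos hexp
  have hac : lawOfMean ref p ≪ lawOfMean ref q := htilt ▸ absolutelyContinuous_tilted hexp
  have hself : Integrable (llr (lawOfMean ref p) (lawOfMean ref p)) (lawOfMean ref p) :=
    (integrable_congr (llr_self _)).2 (integrable_zero _ _ _)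
  have hint : Integrable (llr (lawOfMean ref p) (lawOfMean ref q)) (lawOfMean ref p) := by
    rw [htilt]
    exact integrable_llr_tilted_right Measure.AbsolutelyContinuous.rfl (hid.const_mul _) hself hexp
  have hval : ∫ x, llr (lawOfMean ref p) (lawOfMean ref q) x ∂(lawOfMean ref p) =
      (η - η') * ∫ x, x ∂(lawOfMean ref p) + Real.log (∫ x, Real.exp (f x) ∂(lawOfMean ref p)) := by
    rw [htilt, integral_llr_tilted_right Measure.AbsolutelyContinuous.rfl (hid.const_mul _) hexp
      hself, integral_congr_ae (llr_self _), integral_const_mul]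
    simp
    ring
  -- Gibbs' inequality; the mass terms cancel for probability measures. The sign is recorded because
  -- `ENNReal.ofReal` would hide it, and weighted sums of divergences are later moved inside
  -- `ENNReal.ofReal`.
  have hnonneg := InformationTheory.integral_llr_add_sub_measure_univ_nonneg hac hint
  refine ⟨η - η', Real.log (∫ x, Real.exp (f x) ∂(lawOfMean ref p)), ?_, ?_, ?_⟩
  · rw [htilt, Measure.tilted]
    congr 1
    ext x
    rw [neg_add, Real.exp_add, Real.exp_neg (Real.log _), Real.exp_log hpos, div_eq_mul_inv]
    congr 3
    simp only [hf]
    ring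
  · simpa [hval] using hnonneg
  · rw [InformationTheory.klDiv_of_ac_of_integrable hac hint, hval]
    simp

/-- The exponential moments of an affine function are, to first order, governed by its mean. -/
theorem eventually_lintegral_exp_affine_le {ν : Measure ℝ} [IsProbabilityMeasure ν]
    (h0 : 0 ∈ interior (integrableExpSet id ν)) {α β v : ℝ} (hv : α * ∫ x, x ∂ν + β < v) :
    ∀ᶠ b in 𝓝[>] (0 : ℝ),
      ∫⁻ x, ENNReal.ofReal (Real.exp (b * (α * x + β))) ∂ν ≤ ENNReal.ofReal (Real.exp (b * v)) := by
  have hopen : IsOpen ((fun b : ℝ => b * α) ⁻¹' interior (integrableExpSet id ν)) :=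
    isOpen_interior.preimage (by fun_prop)
  have hmem : ∀ᶠ b in 𝓝 (0 : ℝ), b * α ∈ interior (integrableExpSet id ν) :=
    hopen.mem_nhds (by simpa using h0)
  -- This function is `1` at `b = 0` and has negative slope there, so it is below `1` just to the
  -- right of `0`; multiplying by `exp (b * v)` gives the claim.
  have hderiv : HasDerivAt (fun b : ℝ => Real.exp (b * (β - v)) * mgf id ν (b * α))
      (α * ∫ x, x ∂ν + β - v) 0 := by
    have h1 : HasDerivAt (mgf id ν) (∫ x, x ∂ν) (0 * α) := by
      have := hasDerivAt_mgf (X := id) (μ := ν) (t := 0) h0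
      simpa using this
    have h2 : HasDerivAt (fun b : ℝ => mgf id ν (b * α)) ((∫ x, x ∂ν) * (1 * α)) 0 :=
      HasDerivAt.comp (0 : ℝ) (h := fun b : ℝ => b * α) (h₂ := mgf id ν) h1
        ((hasDerivAt_id (0 : ℝ)).mul_const α)
    have h3 : HasDerivAt (fun b : ℝ => Real.exp (b * (β - v)))
        (Real.exp (0 * (β - v)) * (1 * (β - v))) 0 :=
      ((hasDerivAt_id (0 : ℝ)).mul_const (β - v)).exp
    convert! h3.mul h2 using 1
    simp
    ring
  have hlt : ∀ᶠ b in 𝓝[>] (0 : ℝ), Real.exp (b * (β - v)) * mgf id ν (b * α) < 1 := by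
    have hslope := (hasDerivAt_iff_tendsto_slope.1 hderiv).mono_left
      (nhdsWithin_mono (0 : ℝ) fun b (hb : 0 < b) => hb.ne')
    filter_upwards [hslope.eventually (gt_mem_nhds (show α * ∫ x, x ∂ν + β - v < 0 by linarith)),
      self_mem_nhdsWithin] with b hb (hb0 : 0 < b)
    rw [slope_def_field, sub_zero, div_neg_iff] at hb
    rcases hb with hb | hb
    · exact absurd hb0 (not_lt.2 hb.2.le)
    · simpa using hb.1
  filter_upwards [hlt, nhdsWithin_le_nhds hmem] with b hb hbm
  have hint : Integrable (fun x => Real.exp (b * α * x)) ν :=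
    interior_subset (s := integrableExpSet id ν) hbm
  have hsplit : ∀ x, Real.exp (b * (α * x + β)) = Real.exp (b * β) * Real.exp (b * α * x) := by
    intro x
    rw [← Real.exp_add]
    ring_nf
  simp_rw [hsplit]
  rw [← ofReal_integral_eq_lintegral_ofReal (hint.const_mul _)
    (ae_of_all _ fun x => by positivity), integral_const_mul]
  refine ENNReal.ofReal_le_ofReal ?_
  have hb' : Real.exp (b * (β - v)) * (∫ x, Real.exp (b * α * x) ∂ν) < 1 := hb
  calc Real.exp (b * β) * ∫ x, Real.exp (b * α * x) ∂ν
      = Real.exp (b * v) * (Real.exp (b * (β - v)) * ∫ x, Real.exp (b * α * x) ∂ν) := by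
        rw [← mul_assoc, ← Real.exp_add]
        ring_nf
    _ ≤ Real.exp (b * v) * 1 := by gcongr
    _ = Real.exp (b * v) := mul_one _

/-! ### The law of the observations: marginals and change of measure -/

/-- Index `n` of the filtration sees coordinates below `n`, while `frestrictLe n` also keeps
coordinate `n`. This spare round is why likelihood ratios below run over `n + 1` factors. -/
theorem obsFiltration_le_comap_frestrictLe {K : ℕ} (n : ℕ) :
    obsFiltration K n ≤ MeasurableSpace.comap
      (Preorder.frestrictLe (π := fun _ : ℕ => Fin K × ℝ) n) inferInstance := by
  refine iSup_le fun s => iSup_le fun hs => ?_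
  have : (fun h : Observations K => h s) =
      (fun y : (Finset.Iic n → Fin K × ℝ) => y ⟨s, Finset.mem_Iic.2 hs.le⟩) ∘
        Preorder.frestrictLe (π := fun _ : ℕ => Fin K × ℝ) n := rfl
  rw [this, ← MeasurableSpace.comap_comp]
  exact MeasurableSpace.comap_mono (measurable_pi_apply _).comap_le

namespace PureExplorationProblem

variable {K d : ℕ} (P : PureExplorationProblem K d)

instance isProbabilityMeasure_law (A : BanditAlgorithm K d P.X) (μ : Fin K → ℝ) :
    IsProbabilityMeasure (P.law A μ) := by
  unfold law; infer_instance

theorem map_frestrictLe_zero_law (A : BanditAlgorithm K d P.X) (μ : Fin K → ℝ) :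
    (P.law A μ).map (fun h => h 0) =
      (Measure.dirac A.firstArm).prod (P.rewardKernel μ A.firstArm) := by
  have h1 : (P.law A μ).map (Preorder.frestrictLe (π := fun _ : ℕ => Fin K × ℝ) 0) =
      ((Measure.dirac A.firstArm).prod (P.rewardKernel μ A.firstArm)).map
        (MeasurableEquiv.piUnique (fun _ : Finset.Iic 0 => Fin K × ℝ)).symm := by
    unfold law Kernel.trajMeasure
    rw [Measure.map_comp _ _ (by fun_prop), Kernel.traj_map_frestrictLe,
      Kernel.partialTraj_self, Measure.id_comp]
  have h2 : (fun h : Observations K => h 0) =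
      (MeasurableEquiv.piUnique (fun _ : Finset.Iic 0 => Fin K × ℝ)) ∘
        Preorder.frestrictLe (π := fun _ : ℕ => Fin K × ℝ) 0 := rfl
  rw [h2, ← Measure.map_map (by fun_prop) (by fun_prop), h1,
    Measure.map_map (by fun_prop) (by fun_prop), MeasurableEquiv.self_comp_symm, Measure.map_id]

theorem lintegral_law_zero (A : BanditAlgorithm K d P.X) (μ : Fin K → ℝ)
    {G : Fin K × ℝ → ℝ≥0∞} (hG : Measurable G) :
    ∫⁻ h, G (h 0) ∂(P.law A μ) =
      ∫⁻ r, G (A.firstArm, r) ∂(lawOfMean P.ref (μ A.firstArm)) := by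
  have : ∫⁻ h, G (h 0) ∂(P.law A μ) = ∫⁻ y, G y ∂((P.law A μ).map fun h => h 0) :=
    (lintegral_map hG (by fun_prop)).symm
  rw [this, map_frestrictLe_zero_law, lintegral_prod _ hG.aemeasurable, lintegral_dirac]
  rfl

/-- Disintegration over the past: the next arm is a deterministic function of it, so only the reward
remains to be integrated. -/
theorem lintegral_law_succ (A : BanditAlgorithm K d P.X) (μ : Fin K → ℝ) (n : ℕ)
    {G : (Finset.Iic n → Fin K × ℝ) × (Fin K × ℝ) → ℝ≥0∞} (hG : Measurable G) :
    ∫⁻ h, G (Preorder.frestrictLe n h, h (n + 1)) ∂(P.law A μ) =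
      ∫⁻ h, ∫⁻ r, G (Preorder.frestrictLe n h, (A.nextArm n (Preorder.frestrictLe n h), r))
        ∂(lawOfMean P.ref (μ (A.nextArm n (Preorder.frestrictLe n h)))) ∂(P.law A μ) := by
  have h1 : ∫⁻ h, G (Preorder.frestrictLe n h, h (n + 1)) ∂(P.law A μ) =
      ∫⁻ y, G y ∂((P.law A μ).map fun h => (Preorder.frestrictLe n h, h (n + 1))) :=
    (lintegral_map hG (by fun_prop)).symm
  have h2 : (P.law A μ).map (fun h => (Preorder.frestrictLe n h, h (n + 1))) =
      (P.law A μ).map (Preorder.frestrictLe n) ⊗ₘ P.stepKernel A μ n :=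
    Kernel.map_frestrictLe_trajMeasure_compProd_eq_map_trajMeasure.symm
  rw [h1, h2, Measure.lintegral_compProd hG,
    lintegral_map (Measurable.lintegral_kernel_prod_right' hG) (by fun_prop)]
  refine lintegral_congr fun h => ?_
  have hG' : Measurable fun y => G (Preorder.frestrictLe n h, y) :=
    hG.comp measurable_prodMk_left
  rw [stepKernel, Kernel.lintegral_prod _ _ _ hG']
  rw [Kernel.lintegral_deterministic' (hf := hG'.lintegral_prod_right')]
  rfl

/-- Change of measure on the first `n + 1` rounds. -/
theorem lintegral_law_mul_prod_density (A : BanditAlgorithm K d P.X) {μ l : Fin K → ℝ}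
    {u : Fin K × ℝ → ℝ≥0∞} (hu : Measurable u)
    (hul : ∀ k, lawOfMean P.ref (l k) = (lawOfMean P.ref (μ k)).withDensity fun r => u (k, r))
    (n : ℕ) {F : (Finset.Iic n → Fin K × ℝ) → ℝ≥0∞} (hF : Measurable F) :
    ∫⁻ h, F (Preorder.frestrictLe n h) * ∏ s ∈ Finset.range (n + 1), u (h s) ∂(P.law A μ) =
      ∫⁻ h, F (Preorder.frestrictLe n h) ∂(P.law A l) := by
  have hint : ∀ (k : Fin K) {g : ℝ → ℝ≥0∞}, Measurable g →
      ∫⁻ r, g r * u (k, r) ∂(lawOfMean P.ref (μ k)) = ∫⁻ r, g r ∂(lawOfMean P.ref (l k)) := by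
    intro k g hg
    rw [hul k, lintegral_withDensity_eq_lintegral_mul _ (by fun_prop) hg]
    exact lintegral_congr fun r => mul_comm _ _
  induction n with
  | zero =>
    set e : Fin K × ℝ → (Finset.Iic 0 → Fin K × ℝ) := fun y _ => y with he
    have hem : Measurable e := by fun_prop
    have hre : ∀ h : Observations K, Preorder.frestrictLe 0 h = e (h 0) := by
      intro h
      funext ⟨i, hi⟩
      obtain rfl : i = 0 := by simpa using hi
      rfl
    simp only [hre, zero_add, Finset.range_one, Finset.prod_singleton]
    rw [P.lintegral_law_zero A μ (G := fun y => F (e y) * u y) ((hF.comp hem).mul hu),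
      P.lintegral_law_zero A l (G := fun y => F (e y)) (hF.comp hem)]
    exact hint _ (hF.comp (hem.comp measurable_prodMk_left))
  | succ n ih =>
    -- Appends an observation to a history; the default branch is reached only at index `n + 1`.
    set e : (Finset.Iic n → Fin K × ℝ) × (Fin K × ℝ) → (Finset.Iic (n + 1) → Fin K × ℝ) :=
      fun y i => if hi : (i : ℕ) ∈ Finset.Iic n then y.1 ⟨i, hi⟩ else y.2 with he
    have hem : Measurable e := by
      refine measurable_pi_lambda _ fun i => ?_
      by_cases hi : (i : ℕ) ∈ Finset.Iic n
      · simp only [he, hi, dite_true]; fun_prop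
      · simp only [he, hi, dite_false]; fun_prop
    have hre : ∀ h : Observations K,
        Preorder.frestrictLe (n + 1) h = e (Preorder.frestrictLe n h, h (n + 1)) := by
      intro h
      funext ⟨i, hi⟩
      by_cases hi' : i ∈ Finset.Iic n
      · simp only [he]
        rw [dif_pos hi']
        rfl
      · have : i = n + 1 := by simp at hi hi'; omega
        subst this
        simp [he]
    set w : (Finset.Iic n → Fin K × ℝ) → ℝ≥0∞ := fun y => ∏ s, u (y s) with hw
    have hwm : Measurable w := by fun_prop
    have hwp : ∀ h : Observations K,
        ∏ s ∈ Finset.range (n + 1), u (h s) = w (Preorder.frestrictLe n h) := by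
      intro h
      rw [hw, Nat.range_succ_eq_Iic n, ← Finset.prod_coe_sort]
      rfl
    have hFe : Measurable fun y => F (e y) := hF.comp hem
    have hinner : Measurable fun y : Finset.Iic n → Fin K × ℝ =>
        ∫⁻ r, F (e (y, (A.nextArm n y, r))) ∂(lawOfMean P.ref (l (A.nextArm n y))) := by
      have h1 : Measurable fun z : (Finset.Iic n → Fin K × ℝ) × ℝ =>
          F (e (z.1, (A.nextArm n z.1, z.2))) := by
        have := A.measurable_nextArm n
        fun_prop
      exact Measurable.lintegral_kernel_prod_right'
        (κ := (P.rewardKernel l).comap (A.nextArm n) (A.measurable_nextArm n)) h1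
    simp only [hre, Finset.prod_range_succ _ (n + 1), hwp]
    -- The induction hypothesis is applied to the conditional expectation of `F` under `l` given the
    -- past. The sampling rule is the same in both models, so only the reward law contributes a
    -- density.
    rw [P.lintegral_law_succ A μ n (G := fun y => F (e y) * (w y.1 * u y.2)) (by fun_prop),
      P.lintegral_law_succ A l n (G := fun y => F (e y)) hFe, ← ih hinner]
    refine lintegral_congr fun h => ?_
    rw [hwp, ← hint _ (by fun_prop), ← lintegral_mul_const'' _ (by fun_prop)]
    exact lintegral_congr fun r => by ring

/-- Conditionally on the past, the new factor integrates to at most `C` whichever arm was selected,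
so adaptive sampling costs nothing. -/
theorem lintegral_law_prod_le (A : BanditAlgorithm K d P.X) {μ : Fin K → ℝ}
    {φ : Fin K × ℝ → ℝ≥0∞} (hφ : Measurable φ) {C : ℝ≥0∞}
    (hC : ∀ k, ∫⁻ r, φ (k, r) ∂(lawOfMean P.ref (μ k)) ≤ C) (n : ℕ) :
    ∫⁻ h, ∏ s ∈ Finset.range (n + 1), φ (h s) ∂(P.law A μ) ≤ C ^ (n + 1) := by
  induction n with
  | zero => simpa [P.lintegral_law_zero A μ hφ] using hC A.firstArm
  | succ n ih =>
    set w : (Finset.Iic n → Fin K × ℝ) → ℝ≥0∞ := fun y => ∏ s, φ (y s) with hw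
    have hwm : Measurable w := by fun_prop
    have hwp : ∀ h : Observations K,
        ∏ s ∈ Finset.range (n + 1), φ (h s) = w (Preorder.frestrictLe n h) := by
      intro h
      rw [hw, Nat.range_succ_eq_Iic n, ← Finset.prod_coe_sort]
      rfl
    simp only [hwp] at ih
    simp only [Finset.prod_range_succ _ (n + 1), hwp]
    rw [P.lintegral_law_succ A μ n (G := fun y => w y.1 * φ y.2) (by fun_prop)]
    calc ∫⁻ h, ∫⁻ r, w (Preorder.frestrictLe n h) * φ (A.nextArm n (Preorder.frestrictLe n h), r)
          ∂(lawOfMean P.ref (μ (A.nextArm n (Preorder.frestrictLe n h)))) ∂(P.law A μ)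
        ≤ ∫⁻ h, w (Preorder.frestrictLe n h) * C ∂(P.law A μ) := by
          refine lintegral_mono fun h => ?_
          rw [lintegral_const_mul _ (by fun_prop)]
          gcongr
          exact hC _
      _ = (∫⁻ h, w (Preorder.frestrictLe n h) ∂(P.law A μ)) * C :=
          lintegral_mul_const _ (by fun_prop)
      _ ≤ C ^ (n + 1) * C := by gcongr
      _ = C ^ (n + 1 + 1) := (pow_succ _ _).symm

end PureExplorationProblem

/-! ### ### From weights to mixtures: a minimax principle -/

/-- A minimax principle: if every convex combination of the coordinates is below `v` at some point
of `C`, then some convex combination of points of `C` has all coordinates below `v`. -/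
theorem exists_mem_convexHull_forall_lt {ι : Type*} [Fintype ι] {C : Set (ι → ℝ)} {v : ℝ}
    (hC : C.Nonempty)
    (h : ∀ ω ∈ stdSimplex ℝ ι, ∃ c ∈ C, ∑ k, ω k * c k < v) :
    ∃ c ∈ convexHull ℝ C, ∀ k, c k < v := by
  classical
  by_contra! hcon
  set s : Set (ι → ℝ) := Set.univ.pi fun _ => Set.Iio v
  have hs : Convex ℝ s := convex_pi fun _ _ => convex_Iio v
  have hso : IsOpen s := isOpen_set_pi Set.finite_univ fun _ _ => isOpen_Iio
  have hdisj : Disjoint s (convexHull ℝ C) := by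
    refine Set.disjoint_left.2 fun c hc hcC => ?_
    obtain ⟨k, hk⟩ := hcon c hcC
    exact absurd (hc k trivial) (not_lt.2 hk)
  -- Separate the open orthant below `v` from the convex hull. The coefficients of `f` turn out
  -- nonnegative and, once normalised, are a weight `ω` contradicting `h`.
  obtain ⟨f, u, hfs, hfC⟩ := geometric_hahn_banach_open hs hso (convex_convexHull ℝ C) hdisj
  set a : ι → ℝ := fun k => f (Pi.single k 1) with ha
  have hf : ∀ c : ι → ℝ, f c = ∑ k, a k * c k := by
    intro c
    conv_lhs => rw [← Finset.univ_sum_single c]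
    rw [map_sum]
    refine Finset.sum_congr rfl fun k _ => ?_
    rw [ha, mul_comm, ← smul_eq_mul, ← map_smul, ← Pi.single_smul', smul_eq_mul, mul_one]
  have hnonneg : ∀ k, 0 ≤ a k := by
    intro k
    by_contra! hk
    -- Lowering coordinate `k` stays in the orthant but raises `f` when `a k < 0`; this `t` is large
    -- enough to reach `u`.
    set t : ℝ := max 0 ((f (fun _ => v - 1) - u) / a k) with ht
    have hmem : (fun _ => v - 1) - Pi.single k t ∈ s := by
      intro j _
      have : 0 ≤ (Pi.single k t : ι → ℝ) j := by
        by_cases hj : j = k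
        · subst hj; simp [ht]
        · simp [hj]
      simp only [Pi.sub_apply, Set.mem_Iio]
      linarith
    have hlt := hfs _ hmem
    have hsingle : f (Pi.single k t) = a k * t := by
      rw [hf, Finset.sum_eq_single k (fun j _ hj => by simp [hj]) (by simp)]
      simp
    have hle : a k * t ≤ f (fun _ => v - 1) - u := by
      have := mul_le_mul_of_nonpos_left
        (le_max_right 0 ((f (fun _ => v - 1) - u) / a k)) hk.le
      rwa [mul_div_cancel₀ _ hk.ne] at this
    rw [map_sub, hsingle] at hlt
    linarith
  have hconst : ∀ r < v, (∑ k, a k) * r < u := by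
    intro r hr
    have := hfs (fun _ => r) fun _ _ => hr
    rwa [hf, ← Finset.sum_mul] at this
  -- A vanishing sum means `f = 0`, which a point of `C` excludes through `0 < u ≤ 0`.
  rcases (Finset.sum_nonneg fun k _ => hnonneg k : 0 ≤ ∑ k, a k).eq_or_lt with hA | hA
  · obtain ⟨c, hc⟩ := hC
    have hzero : ∀ k, a k = 0 := fun k =>
      (Finset.sum_eq_zero_iff_of_nonneg fun k _ => hnonneg k).1 hA.symm k (Finset.mem_univ k)
    have h1 := hfC c (subset_convexHull ℝ C hc)
    have h2 := hconst (v - 1) (by linarith)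
    simp [hf, hzero] at h1
    simp [hzero] at h2
    linarith
  · obtain ⟨c, hc, hlt⟩ := h (fun k => a k / ∑ j, a j)
      ⟨fun k => div_nonneg (hnonneg k) hA.le, by rw [← Finset.sum_div, div_self hA.ne']⟩
    have hfc : ∑ k, a k / (∑ j, a j) * c k = f c / ∑ j, a j := by
      rw [hf, Finset.sum_div]
      exact Finset.sum_congr rfl fun k _ => by ring
    have h1 := hconst _ (hfc ▸ hlt)
    rw [mul_div_cancel₀ _ hA.ne'] at h1
    exact absurd (hfC c (subset_convexHull ℝ C hc)) (not_le.2 h1)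

/-! ### ### Early answers in a fixed region are unlikely -/

namespace PureExplorationProblem

variable {K d : ℕ} (P : PureExplorationProblem K d)

theorem M_subset_models : P.M ⊆ P.models := P.M_subset

theorem mem_meanSpace_of_mem_models {μ : Fin K → ℝ} (hμ : μ ∈ P.models) (k : Fin K) :
    μ k ∈ meanSpace P.ref :=
  P.Θ_subset (hμ k trivial)

theorem measurableSet_stop_le_and_answer_mem (A : BanditAlgorithm K d P.X)
    {S : Set (EuclideanSpace ℝ (Fin d))} (hS : MeasurableSet S) (n : ℕ) :
    MeasurableSet[obsFiltration K n] {h | A.τ h ≤ (n : ℕ∞) ∧ A.answer h ∈ S} := by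
  have := (A.measurable_answer hS).2 n
  rw [Set.inter_comm] at this
  exact this

/-- Finitely many alternatives and weights for which the averaged log-likelihood ratio with respect
to `μ` is affine in the reward, with mean less than `v` for every arm. -/
theorem exists_mixture_of_divWeighted_lt {μ : Fin K → ℝ} (hμ : μ ∈ P.models)
    {L : Set (Fin K → ℝ)} (hL : L ⊆ P.models) (hne : L.Nonempty) {v : ℝ}
    (hv : ∀ ω ∈ stdSimplex ℝ (Fin K), P.divWeighted μ ω L < ENNReal.ofReal v) :
    ∃ (ι : Type) (_ : Fintype ι) (w : ι → ℝ) (l : ι → Fin K → ℝ) (α β : ι → Fin K → ℝ),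
      (∀ i, 0 ≤ w i) ∧ ∑ i, w i = 1 ∧ (∀ i, l i ∈ L) ∧
      (∀ i k, lawOfMean P.ref (l i k) = (lawOfMean P.ref (μ k)).withDensity
        (fun r => ENNReal.ofReal (Real.exp (-(α i k * r + β i k))))) ∧
      ∀ k, (∑ i, w i * α i k) * ∫ x, x ∂(lawOfMean P.ref (μ k)) + ∑ i, w i * β i k < v := by
  choose! α β hd h0 hkl using fun (l : Fin K → ℝ) (hl : l ∈ L) (k : Fin K) =>
    exists_density_lawOfMean P.ref_ne_zero (P.mem_meanSpace_of_mem_models hμ k)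
      (P.mem_meanSpace_of_mem_models (hL hl) k)
  set m : Fin K → ℝ := fun k => ∫ x, x ∂(lawOfMean P.ref (μ k)) with hm
  -- The minimax principle is applied to the vectors of armwise divergences from `μ`.
  obtain ⟨c, hc, hcv⟩ := exists_mem_convexHull_forall_lt (v := v)
    (C := (fun l k => α l k * m k + β l k) '' L) (hne.image _) (by
      intro ω hω
      have h := hv ω hω
      unfold divWeighted at h
      simp only [iInf_lt_iff] at h
      obtain ⟨l, hl, h⟩ := h
      refine ⟨_, ⟨l, hl, rfl⟩, ?_⟩
      have hsum : ∑ k, ENNReal.ofReal (ω k) * P.kl (μ k) (l k) =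
          ENNReal.ofReal (∑ k, ω k * (α l k * m k + β l k)) := by
        rw [ENNReal.ofReal_sum_of_nonneg fun k _ => mul_nonneg (hω.1 k) (h0 l hl k)]
        refine Finset.sum_congr rfl fun k _ => ?_
        rw [ENNReal.ofReal_mul (hω.1 k), kl, hkl l hl k]
      rw [hsum] at h
      exact (ENNReal.ofReal_lt_ofReal_iff_of_nonneg
        (Finset.sum_nonneg fun k _ => mul_nonneg (hω.1 k) (h0 l hl k))).1 h)
  obtain ⟨ι, hι, w, z, hw, hw1, hz, hwz⟩ := mem_convexHull_iff_exists_fintype.1 hc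
  choose l hl hlz using hz
  refine ⟨ι, hι, w, l, fun i => α (l i), fun i => β (l i), hw, hw1, hl,
    fun i k => hd _ (hl i) k, fun k => ?_⟩
  refine lt_of_eq_of_lt ?_ (hcv k)
  rw [← hwz, Finset.sum_apply, Finset.sum_mul, ← Finset.sum_add_distrib]
  refine Finset.sum_congr rfl fun i _ => ?_
  simp only [← hlz i, Pi.smul_apply, smul_eq_mul]
  ring

/-- A correct algorithm can give an early answer from `S` only with small probability. -/
theorem exists_law_stop_le_and_answer_mem_le {μ : Fin K → ℝ} (hμ : μ ∈ P.models)
    {S : Set (EuclideanSpace ℝ (Fin d))} (hS : MeasurableSet S) (hne : (P.alt S).Nonempty) {v : ℝ}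
    (hv : ∀ ω ∈ stdSimplex ℝ (Fin K), P.divWeighted μ ω (P.alt S) < ENNReal.ofReal v) :
    ∃ b : ℝ, 0 < b ∧ ∀ (δ : ℝ) (A : BanditAlgorithm K d P.X), P.IsCorrect δ A → ∀ (n : ℕ) (c : ℝ),
      P.law A μ {h | A.τ h ≤ (n : ℕ∞) ∧ A.answer h ∈ S} ≤
        ENNReal.ofReal (Real.exp c * δ) + ENNReal.ofReal (Real.exp (-b * (c - v * (n + 1)))) := by
  obtain ⟨ι, _, w, l, α, β, hw, hw1, hl, hd, hlt⟩ :=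
    P.exists_mixture_of_divWeighted_lt hμ (fun l hl => P.M_subset_models hl.1) hne hv
  have hprob : ∀ k, IsProbabilityMeasure (lawOfMean P.ref (μ k)) := fun k =>
    isProbabilityMeasure_lawOfMean P.ref_ne_zero (μ k)
  -- There are finitely many arms, so one exponent `b` serves them all.
  obtain ⟨b, hb, hb0⟩ := ((eventually_all.2 fun k => eventually_lintegral_exp_affine_le
    (zero_mem_interior_integrableExpSet_lawOfMean (P.mem_meanSpace_of_mem_models hμ k))
    (hlt k)).and self_mem_nhdsWithin).exists
  refine ⟨b, hb0, fun δ A hA n c => ?_⟩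
  set E : Set (Observations K) := {h | A.τ h ≤ (n : ℕ∞) ∧ A.answer h ∈ S} with hE
  have hEn := P.measurableSet_stop_le_and_answer_mem A hS n
  have hEm : MeasurableSet E := (obsFiltration K).le n _ hEn
  obtain ⟨E', hE', hEE'⟩ := obsFiltration_le_comap_frestrictLe n _ hEn
  set y : ι → Fin K × ℝ → ℝ := fun i a => α i a.1 * a.2 + β i a.1 with hy
  set g : Fin K × ℝ → ℝ := fun a => ∑ i, w i * y i a with hg
  have hym : ∀ i, Measurable (y i) := fun i => by
    have h1 : Measurable (α i) := measurable_of_countable _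
    have h2 : Measurable (β i) := measurable_of_countable _
    fun_prop
  have hgm : Measurable g := by fun_prop
  have hg_affine : ∀ k r, g (k, r) = (∑ i, w i * α i k) * r + ∑ i, w i * β i k := by
    intro k r
    simp only [hg, hy, Finset.sum_mul, ← Finset.sum_add_distrib]
    exact Finset.sum_congr rfl fun i _ => by ring
  set F : (Finset.Iic n → Fin K × ℝ) → ℝ≥0∞ := E'.indicator 1 with hF
  have hFm : Measurable F := measurable_one.indicator hE'
  have hFE : ∀ h, F (Preorder.frestrictLe n h) = E.indicator 1 h := by
    intro h
    change _ = E at hEE'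
    rw [← hEE']
    rfl
  have hprod : ∀ (φ : Fin K × ℝ → ℝ) (h : Observations K),
      ∏ s ∈ Finset.range (n + 1), ENNReal.ofReal (Real.exp (φ (h s))) =
        ENNReal.ofReal (Real.exp (∑ s ∈ Finset.range (n + 1), φ (h s))) := by
    intro φ h
    rw [Real.exp_sum, ENNReal.ofReal_prod_of_nonneg fun s _ => (Real.exp_pos _).le]
  -- Every answer in `S` is wrong in the model `l i`, so `δ`-correctness there bounds the
  -- probability of `E`.
  have hchange : ∀ i, ∫⁻ h, F (Preorder.frestrictLe n h) *
      ∏ s ∈ Finset.range (n + 1), ENNReal.ofReal (Real.exp (-(y i (h s)))) ∂(P.law A μ) ≤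
        ENNReal.ofReal δ := by
    intro i
    rw [P.lintegral_law_mul_prod_density A (u := fun a => ENNReal.ofReal (Real.exp (-(y i a))))
      (by fun_prop) (hd i) n hFm]
    simp only [hFE]
    rw [lintegral_indicator_one hEm]
    refine (measure_mono fun h hh => ?_).trans (hA (l i) (hl i).1)
    exact ⟨ne_top_of_le_ne_top (ENat.natCast_ne_top n) hh.1, (hl i).2 _ hh.2⟩
  have hmgf : ∫⁻ h, ∏ s ∈ Finset.range (n + 1), ENNReal.ofReal (Real.exp (b * g (h s)))
      ∂(P.law A μ) ≤ ENNReal.ofReal (Real.exp (b * v)) ^ (n + 1) := by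
    refine P.lintegral_law_prod_le A (φ := fun a => ENNReal.ofReal (Real.exp (b * g a)))
      (by fun_prop) (fun k => ?_) n
    simp only [hg_affine]
    exact hb k
  -- On `E`, one of the two summands is at least `1`, according to whether the accumulated averaged
  -- log-likelihood ratio is at most `c`.
  have hpoint : ∀ h, E.indicator (1 : Observations K → ℝ≥0∞) h ≤
      ENNReal.ofReal (Real.exp c) * (∑ i, ENNReal.ofReal (w i) * (F (Preorder.frestrictLe n h) *
        ∏ s ∈ Finset.range (n + 1), ENNReal.ofReal (Real.exp (-(y i (h s)))))) +
      ENNReal.ofReal (Real.exp (-b * c)) *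
        ∏ s ∈ Finset.range (n + 1), ENNReal.ofReal (Real.exp (b * g (h s))) := by
    intro h
    by_cases hh : h ∈ E
    swap
    · simp [hh]
    simp only [hFE, hh, Set.indicator_of_mem, Pi.one_apply, one_mul]
    rw [hprod (fun a => b * g a) h]
    have hprod' : ∀ i, ∏ s ∈ Finset.range (n + 1), ENNReal.ofReal (Real.exp (-(y i (h s)))) =
        ENNReal.ofReal (Real.exp (∑ s ∈ Finset.range (n + 1), -(y i (h s)))) :=
      fun i => hprod (fun a => -(y i a)) h
    simp only [hprod']
    rw [← ENNReal.ofReal_mul (Real.exp_pos _).le, ← Real.exp_add, ← Finset.mul_sum]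
    have hmean : ∑ s ∈ Finset.range (n + 1), g (h s) =
        -∑ i, w i * ∑ s ∈ Finset.range (n + 1), -(y i (h s)) := by
      simp only [hg, Finset.mul_sum]
      rw [Finset.sum_comm]
      simp
    rcases le_total (∑ s ∈ Finset.range (n + 1), g (h s)) c with hle | hle
    -- By Jensen the mixture of likelihood ratios is at least the exponential of minus the averaged
    -- log-ratio, hence at least `exp (-c)`.
    · refine le_trans ?_ (self_le_add_right _ _)
      have hjensen := convexOn_exp.map_sum_le (t := Finset.univ) (w := w)
        (p := fun i => ∑ s ∈ Finset.range (n + 1), -(y i (h s))) (fun i _ => hw i) hw1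
        (fun _ _ => Set.mem_univ _)
      simp only [smul_eq_mul] at hjensen
      have hsum : ∑ i, ENNReal.ofReal (w i) *
          ENNReal.ofReal (Real.exp (∑ s ∈ Finset.range (n + 1), -(y i (h s)))) =
          ENNReal.ofReal (∑ i, w i * Real.exp (∑ s ∈ Finset.range (n + 1), -(y i (h s)))) := by
        rw [ENNReal.ofReal_sum_of_nonneg fun i _ => mul_nonneg (hw i) (Real.exp_pos _).le]
        exact Finset.sum_congr rfl fun i _ => (ENNReal.ofReal_mul (hw i)).symm
      rw [hsum, ← ENNReal.ofReal_mul (Real.exp_pos _).le, ENNReal.one_le_ofReal]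
      calc (1 : ℝ) ≤ Real.exp (c + ∑ i, w i * ∑ s ∈ Finset.range (n + 1), -(y i (h s))) :=
            Real.one_le_exp (by linarith)
        _ ≤ _ := by rw [Real.exp_add]; gcongr
    -- The Chernoff case: `exp (b * (∑ g - c)) ≥ 1`.
    · refine le_trans ?_ (self_le_add_left _ _)
      rw [ENNReal.one_le_ofReal]
      exact Real.one_le_exp (by nlinarith [mul_le_mul_of_nonneg_left hle (le_of_lt hb0)])
  have hum : ∀ i, Measurable fun h : Observations K => F (Preorder.frestrictLe n h) *
      ∏ s ∈ Finset.range (n + 1), ENNReal.ofReal (Real.exp (-(y i (h s)))) := by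
    intro i; fun_prop
  calc P.law A μ E = ∫⁻ h, E.indicator 1 h ∂(P.law A μ) := (lintegral_indicator_one hEm).symm
    _ ≤ _ := lintegral_mono hpoint
    _ = ENNReal.ofReal (Real.exp c) * (∑ i, ENNReal.ofReal (w i) *
          ∫⁻ h, F (Preorder.frestrictLe n h) * ∏ s ∈ Finset.range (n + 1),
            ENNReal.ofReal (Real.exp (-(y i (h s)))) ∂(P.law A μ)) +
        ENNReal.ofReal (Real.exp (-b * c)) * ∫⁻ h, ∏ s ∈ Finset.range (n + 1),
          ENNReal.ofReal (Real.exp (b * g (h s))) ∂(P.law A μ) := by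
      rw [lintegral_add_right _ (by fun_prop), lintegral_const_mul _ (by fun_prop),
        lintegral_const_mul _ (by fun_prop), lintegral_finsetSum _ (by fun_prop)]
      simp only [lintegral_const_mul _ (hum _)]
    _ ≤ ENNReal.ofReal (Real.exp c) * (∑ i, ENNReal.ofReal (w i) * ENNReal.ofReal δ) +
        ENNReal.ofReal (Real.exp (-b * c)) * ENNReal.ofReal (Real.exp (b * v)) ^ (n + 1) := by
      gcongr with i
      exact hchange i
    _ = _ := by
      rw [← Finset.sum_mul, ← ENNReal.ofReal_sum_of_nonneg fun i _ => hw i, hw1,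
        ENNReal.ofReal_one, one_mul, ← ENNReal.ofReal_mul (Real.exp_pos _).le,
        ← ENNReal.ofReal_pow (Real.exp_pos _).le, ← Real.exp_nat_mul,
        ← ENNReal.ofReal_mul (Real.exp_pos _).le, ← Real.exp_add]
      congr 3
      push_cast
      ring

/-- If an algorithm stops within `n` rounds with probability at most `p`, then its expected
stopping time is at least `(n + 1) * (1 - p)`. -/
theorem mul_one_sub_le_expectedStop (A : BanditAlgorithm K d P.X) (μ : Fin K → ℝ) (n : ℕ)
    {p : ℝ} (hp : P.law A μ {h | A.τ h ≤ (n : ℕ∞)} ≤ ENNReal.ofReal p) (hp0 : 0 ≤ p) :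
    ENNReal.ofReal ((n + 1) * (1 - p)) ≤ P.expectedStop A μ := by
  set E : Set (Observations K) := {h | A.τ h ≤ (n : ℕ∞)} with hE
  have hEm : MeasurableSet E := (obsFiltration K).le n _ (A.isStoppingTime_τ n)
  have hcompl : ENNReal.ofReal (1 - p) ≤ P.law A μ Eᶜ := by
    rw [prob_compl_eq_one_sub hEm, ENNReal.ofReal_sub _ hp0, ENNReal.ofReal_one]
    gcongr
  calc ENNReal.ofReal ((n + 1) * (1 - p))
      = ((n + 1 : ℕ) : ℝ≥0∞) * ENNReal.ofReal (1 - p) := by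
        rw [ENNReal.ofReal_mul (by positivity), ← ENNReal.ofReal_natCast]
        push_cast
        rfl
    _ ≤ ((n + 1 : ℕ) : ℝ≥0∞) * P.law A μ Eᶜ := by gcongr
    _ = ∫⁻ h, Eᶜ.indicator (fun _ => ((n + 1 : ℕ) : ℝ≥0∞)) h ∂(P.law A μ) :=
        (lintegral_indicator_const hEm.compl _).symm
    _ ≤ P.expectedStop A μ := by
        refine lintegral_mono fun h => Set.indicator_le (g := fun h => (A.τ h : ℝ≥0∞)) (fun h hh => ?_) h
        have hh' : (n : ℕ∞) < A.τ h := not_le.1 hh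
        have : ((n + 1 : ℕ) : ℕ∞) ≤ A.τ h := by
          push_cast
          exact Order.add_one_le_of_lt hh'
        exact_mod_cast ENat.toENNReal_le.2 this

/-! ### ### Covering the correct answers, and the limit of small error -/

theorem measurableSet_ball (hX : IsCompact P.X) (ρ : ℝ) (x : EuclideanSpace ℝ (Fin d)) :
    MeasurableSet (P.ball ρ x) :=
  hX.measurableSet.inter
    (measurableSet_le (f := fun y => ‖x - y‖) (g := fun _ => ρ) (by fun_prop) (by fun_prop))

/-- For every `v` above `D(μ)`, a correct algorithm stops early with a probability that is bounded
by finitely many exponentially small terms. -/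
theorem exists_law_stop_le (hP : P.IsRegular) {μ : Fin K → ℝ} (hμ : μ ∈ P.M) {v : ℝ} (hv : 0 < v)
    (hD : P.divModel μ < ENNReal.ofReal v) :
    ∃ (t : Finset (EuclideanSpace ℝ (Fin d))) (b : EuclideanSpace ℝ (Fin d) → ℝ),
      (∀ x ∈ t, 0 < b x) ∧ ∀ (δ : ℝ) (A : BanditAlgorithm K d P.X), 0 ≤ δ → P.IsCorrect δ A →
        ∀ (n : ℕ) (c : ℝ), P.law A μ {h | A.τ h ≤ (n : ℕ∞)} ≤
          ENNReal.ofReal (δ + ∑ x ∈ t,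
            (Real.exp c * δ + Real.exp (-b x * (c - v * (n + 1))))) := by
  have hμ' := P.M_subset_models hμ
  obtain ⟨ε₀, hε₀, hreg⟩ := hP.continuous_alt
  have hDtop : P.divModel μ ≠ ⊤ := ne_top_of_lt hD
  have hDv : (P.divModel μ).toReal < v := (ENNReal.lt_ofReal_iff_toReal_lt hDtop).1 hD
  -- Half the gap between `D(μ)` and `v`, capped because regularity speaks only of small `ε`.
  set ε : ℝ := min ((v - (P.divModel μ).toReal) / 2) (ε₀ / 2) with hε
  have hε0 : 0 < ε := lt_min (by linarith) (by linarith)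
  have hεlt : (P.divModel μ).toReal + ε < v := by
    have := min_le_left ((v - (P.divModel μ).toReal) / 2) (ε₀ / 2)
    linarith
  obtain ⟨ρ, hρ, hball⟩ := hreg ε hε0 ((min_le_right _ _).trans_lt (by linarith))
  obtain ⟨t, htX, htfin, hcover⟩ := (hP.isCompact_Xstar μ hμ').finite_cover_balls hρ
  lift t to Finset (EuclideanSpace ℝ (Fin d)) using htfin
  have hbound : ∀ x ∈ t, ∃ b : ℝ, 0 < b ∧ ∀ (δ : ℝ) (A : BanditAlgorithm K d P.X),
      P.IsCorrect δ A → ∀ (n : ℕ) (c : ℝ),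
      P.law A μ {h | A.τ h ≤ (n : ℕ∞) ∧ A.answer h ∈ P.ball ρ x} ≤
        ENNReal.ofReal (Real.exp c * δ) + ENNReal.ofReal (Real.exp (-b * (c - v * (n + 1)))) := by
    intro x hx
    have hxs : x ∈ P.Xstar μ := htX hx
    have hxX : x ∈ P.X := P.Xstar_subset μ hμ' hxs
    by_cases hne : (P.alt (P.ball ρ x)).Nonempty
    · refine P.exists_law_stop_le_and_answer_mem_le hμ' (P.measurableSet_ball hP.isCompact_X ρ x)
        hne fun ω hω => ?_
      calc P.divWeighted μ ω (P.alt (P.ball ρ x))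
          ≤ P.divWeighted μ ω (P.alt {x}) + ENNReal.ofReal ε := (hball μ hμ' ω hω x hxX).2
        _ ≤ P.divModel μ + ENNReal.ofReal ε := by
            gcongr
            exact (le_iSup₂ (f := fun ω (_ : ω ∈ stdSimplex ℝ (Fin K)) =>
              P.divWeighted μ ω (P.alt {x})) ω hω).trans
              (le_iSup₂ (f := fun x (_ : x ∈ P.Xstar μ) => P.divSet μ (P.alt {x})) x hxs)
        _ < ENNReal.ofReal v := by
            rw [← ENNReal.ofReal_toReal hDtop, ← ENNReal.ofReal_add ENNReal.toReal_nonneg hε0.le]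
            exact (ENNReal.ofReal_lt_ofReal_iff hv).2 hεlt
    · refine ⟨1, one_pos, fun δ A hA n c => ?_⟩
      -- Regularity asserts nonemptiness only alongside a weight `ω`; the first arm supplies a
      -- vertex of the simplex.
      have k := A.firstArm
      exact absurd (hball μ hμ' (Pi.single k 1) (single_mem_stdSimplex ℝ k) x hxX).1 hne
  choose! b hb0 hb using hbound
  refine ⟨t, b, hb0, fun δ A hδ hA n c => ?_⟩
  -- An early stop either returns a wrong answer, at cost `δ`, or answers in a ball of the cover.
  have hsub : {h | A.τ h ≤ (n : ℕ∞)} ⊆ {h | A.τ h ≠ ⊤ ∧ A.answer h ∉ P.Xstar μ} ∪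
      ⋃ x ∈ t, {h | A.τ h ≤ (n : ℕ∞) ∧ A.answer h ∈ P.ball ρ x} := by
    intro h hh
    by_cases hans : A.answer h ∈ P.Xstar μ
    · right
      obtain ⟨x, hx, hxb⟩ := Set.mem_iUnion₂.1 (hcover hans)
      refine Set.mem_iUnion₂.2 ⟨x, hx, hh, A.answer_mem h, ?_⟩
      rw [← dist_eq_norm, dist_comm]
      exact (Metric.mem_ball.1 hxb).le
    · exact Or.inl ⟨ne_top_of_le_ne_top (ENat.natCast_ne_top n) hh, hans⟩
  have hpos : ∀ x ∈ t, 0 ≤ Real.exp c * δ + Real.exp (-b x * (c - v * (n + 1))) :=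
    fun x _ => by positivity
  calc P.law A μ {h | A.τ h ≤ (n : ℕ∞)}
      ≤ P.law A μ {h | A.τ h ≠ ⊤ ∧ A.answer h ∉ P.Xstar μ} +
        ∑ x ∈ t, P.law A μ {h | A.τ h ≤ (n : ℕ∞) ∧ A.answer h ∈ P.ball ρ x} :=
        (measure_mono hsub).trans ((measure_union_le _ _).trans
          (add_le_add le_rfl (measure_biUnion_finset_le _ _)))
    _ ≤ ENNReal.ofReal δ + ∑ x ∈ t, (ENNReal.ofReal (Real.exp c * δ) +
          ENNReal.ofReal (Real.exp (-b x * (c - v * (n + 1))))) :=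
        add_le_add (hA μ hμ) (Finset.sum_le_sum fun x hx => hb x hx δ A hA n c)
    _ = _ := by
        rw [ENNReal.ofReal_add hδ (Finset.sum_nonneg hpos), ENNReal.ofReal_sum_of_nonneg hpos]
        congr 1
        exact Finset.sum_congr rfl fun x _ =>
          (ENNReal.ofReal_add (by positivity) (by positivity)).symm

/-- With `L = log(1/δ)`, stopping within about `L / w` rounds has vanishing probability for a `w`
just below `v`; the room between `w` and `v` absorbs this probability in Markov's inequality. -/
theorem ofReal_inv_le_liminf_expectedStop (hP : P.IsRegular) (A : ℝ → BanditAlgorithm K d P.X)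
    (hA : ∀ δ : ℝ, 0 < δ → δ < 1 → P.IsCorrect δ (A δ)) {μ : Fin K → ℝ} (hμ : μ ∈ P.M) {v : ℝ}
    (hD : P.divModel μ < ENNReal.ofReal v) :
    ENNReal.ofReal v⁻¹ ≤ liminf
      (fun δ : ℝ => P.expectedStop (A δ) μ / ENNReal.ofReal (Real.log (1 / δ))) (𝓝[>] 0) := by
  obtain ⟨v₀', hDv₀, hv₀v'⟩ := ENNReal.lt_iff_exists_nnreal_btwn.1 hD
  have hv : 0 < v := ENNReal.ofReal_pos.1 (pos_of_gt hD)
  rw [← ENNReal.ofReal_coe_nnreal] at hDv₀ hv₀v'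
  have hv₀ : 0 ≤ (v₀' : ℝ) := v₀'.2
  generalize (v₀' : ℝ) = v₀ at hDv₀ hv₀v' hv₀
  have hv₀pos : 0 < v₀ := ENNReal.ofReal_pos.1 (pos_of_gt hDv₀)
  have hv₀v : v₀ < v := (ENNReal.ofReal_lt_ofReal_iff hv).1 hv₀v'
  obtain ⟨w, hv₀w, hwv⟩ := exists_between hv₀v
  have hw : 0 < w := hv₀pos.trans hv₀w
  -- The threshold is `c = θ L`: `θ < 1` makes `e^c δ` vanish, and `v₀ / w < θ` keeps `c` above the
  -- drift `v₀ (n + 1)` for large `L`. The extra round is the term `- v₀` in `B`.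
  obtain ⟨θ, hθ, hθ1⟩ := exists_between ((div_lt_one hw).2 hv₀w)
  obtain ⟨t, b, hb0, hb⟩ := P.exists_law_stop_le hP hμ hv₀pos hDv₀
  set B : ℝ → ℝ := fun L => Real.exp (-L) + ∑ x ∈ t,
    (Real.exp (-((1 - θ) * L)) + Real.exp (-(b x * ((θ - v₀ / w) * L - v₀)))) with hB
  have hBlim : Tendsto B atTop (𝓝 0) := by
    have h0 : (0 : ℝ) = 0 + ∑ x ∈ t, (0 + 0) := by simp
    rw [h0]
    refine Real.tendsto_exp_neg_atTop_nhds_zero.add (tendsto_finsetSum _ fun x hx => ?_)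
    refine (Real.tendsto_exp_neg_atTop_nhds_zero.comp
      (tendsto_id.const_mul_atTop (sub_pos.2 hθ1))).add
      (Real.tendsto_exp_neg_atTop_nhds_zero.comp ?_)
    exact Tendsto.const_mul_atTop (hb0 x hx) (tendsto_atTop_add_const_right _ _
      (tendsto_id.const_mul_atTop (sub_pos.2 hθ)))
  have hlog : Tendsto (fun δ : ℝ => Real.log (1 / δ)) (𝓝[>] 0) atTop := by
    simp only [one_div]
    exact Real.tendsto_log_atTop.comp tendsto_inv_nhdsGT_zero
  refine le_liminf_of_le (by isBoundedDefault) ?_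
  have hwv1 : 0 < 1 - w / v := sub_pos.2 ((div_lt_one hv).2 hwv)
  filter_upwards [(hBlim.comp hlog).eventually (gt_mem_nhds hwv1),
    hlog.eventually (eventually_gt_atTop 0), Ioo_mem_nhdsGT (zero_lt_one' ℝ)] with δ hBδ hL hδ
  simp only [Function.comp_apply] at hBδ
  set L : ℝ := Real.log (1 / δ) with hLdef
  have hδL : δ = Real.exp (-L) := by
    rw [hLdef, one_div, Real.log_inv, neg_neg, Real.exp_log hδ.1]
  set n : ℕ := ⌊L / w⌋₊ with hn
  have hn1 : (n : ℝ) ≤ L / w := Nat.floor_le (by positivity)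
  have hn2 : L / w < n + 1 := Nat.lt_floor_add_one _
  have hearly : P.law (A δ) μ {h | (A δ).τ h ≤ (n : ℕ∞)} ≤ ENNReal.ofReal (B L) := by
    refine (hb δ (A δ) hδ.1.le (hA δ hδ.1 hδ.2) n (θ * L)).trans (ENNReal.ofReal_le_ofReal ?_)
    rw [hB]
    refine add_le_add hδL.le (Finset.sum_le_sum fun x hx => add_le_add ?_ ?_)
    · rw [hδL, ← Real.exp_add]
      exact Real.exp_le_exp.2 (by linarith)
    · refine Real.exp_le_exp.2 ?_
      rw [neg_mul]
      refine neg_le_neg (mul_le_mul_of_nonneg_left ?_ (hb0 x hx).le)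
      have h1 : v₀ * n ≤ v₀ * (L / w) := mul_le_mul_of_nonneg_left hn1 hv₀
      have h2 : v₀ * (L / w) = v₀ / w * L := by ring
      linarith
  have hBnonneg : 0 ≤ B L := add_nonneg (Real.exp_pos _).le
    (Finset.sum_nonneg fun x _ => add_nonneg (Real.exp_pos _).le (Real.exp_pos _).le)
  rw [ENNReal.le_div_iff_mul_le (Or.inl (ENNReal.ofReal_pos.2 hL).ne')
      (Or.inl ENNReal.ofReal_ne_top),
    ← ENNReal.ofReal_mul (by positivity)]
  refine (ENNReal.ofReal_le_ofReal ?_).trans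
    (P.mul_one_sub_le_expectedStop (A δ) μ n hearly hBnonneg)
  calc v⁻¹ * L = L / w * (w / v) := by field_simp
    _ ≤ (n + 1) * (1 - B L) := by
        have : 0 < w / v := by positivity
        gcongr
        linarith

end PureExplorationProblem

theorem mainTheorem1 {K d : ℕ} (P : PureExplorationProblem K d) (hP : P.IsRegular)
    (A : ℝ → BanditAlgorithm K d P.X)
    (hA : ∀ δ : ℝ, 0 < δ → δ < 1 → P.IsCorrect δ (A δ))
    (μ : Fin K → ℝ) (hμ : μ ∈ P.M) :
    1 / P.divModel μ ≤
      Filter.liminf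
        (fun δ : ℝ => P.expectedStop (A δ) μ / ENNReal.ofReal (Real.log (1 / δ)))
        (nhdsWithin 0 (Set.Ioi 0)) := by
  rw [one_div]
  -- A real `v` strictly between `D(μ)` and the inverse of the liminf is necessarily positive and
  -- finite, so `D(μ) = 0` and `D(μ) = ⊤` need no separate treatment.
  by_contra! hlt
  obtain ⟨v, hDv, hv⟩ := ENNReal.lt_iff_exists_nnreal_btwn.1 (ENNReal.lt_inv_iff_lt_inv.1 hlt)
  rw [← ENNReal.ofReal_coe_nnreal] at hDv hv
  have hvpos : (0 : ℝ) < v := ENNReal.ofReal_pos.1 (pos_of_gt hDv)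
  have h := P.ofReal_inv_le_liminf_expectedStop hP A hA hμ hDv
  rw [ENNReal.ofReal_inv_of_pos hvpos] at h
  exact absurd (ENNReal.lt_inv_iff_lt_inv.1 hv) (not_lt.2 h)
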